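/- Let $k\ge 2$ and let $H=K_{k+1}^{(k)}$ be the $k$-uniform simplex, i.e. the hypergraph with vertex set $[k+1]$ whose edges are all $k$-subsets of $[k+1]$. A \emph{rooting} of $H$ is a sequence $R=((e_1,v_1),\dots,(e_{k+1},v_{k+1}))$ in which $e_1,\dots,e_{k+1}$ are the edges of $H$ (each once), $v_i\in e_i$, and $v_1\le v_2\le\dots\le v_{k+1}$; its rooted multi-digraph $D_R$ is the union (adding multiplicities) of the stars $\{v_iv : v\in e_i,\ v\ne v_i\}$. Call $R$ an \emph{Euler rooting} if $D_R$ has an Euler circuit. Let $$C_H=\sum_{R}\frac{\tau_{D_R}}{\prod_{v\in V(D_R)}\deg^-_{D_R}(v)},$$ where $R$ runs over the Euler rootings of $H$ and $\tau_{D}$ is the number of spanning arborescences of $D$ with a specified root $r\in[k+1]$ (the statement holds for every choice of $r$), and put $C_k=(k-1)^kC_H$. Let $P_{\ge2}(k+1)$ be the set of partitions of $k+1$ into parts of size at least $2$; for $p=(p_1,\dots,p_t)\in P_{\ge 2}(k+1)$ let $\mathfrak D_{k+1}(p)$ be the set of derangements of $[k+1]$ whose cycle lengths are the parts of $p$, and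 let $V_p(i)=|\{j: p_j=i\}|$. Then $$C_k=\frac{1}{(k-1)(k+1)^2}\sum_{p=(p_1,\dots,p_t)\in P_{\ge2}(k+1)}|\mathfrak D_{k+1}(p)|\prod_{i=1}^t\left(k^{p_i}+(-1)^{p_i+1}\right),$$ and, for every $p=(p_1,\dots,p_t)\in P_{\ge2}(k+1)$, $$|\mathfrak D_{k+1}(p)|=\frac{(k+1)!}{\left(\prod_{i=1}^t p_i\right)\left(\prod_{i=2}^{k+1}V_p(i)!\right)}.$$ -/

import Mathlib

/-- A directed multigraph with vertices in `V` and distinguishable arcs in `E`. -/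
structure MultiDigraph (V E : Type*) where
  src : E → V
  tgt : E → V

namespace MultiDigraph

variable {V E : Type*} [Fintype V] [DecidableEq V] [Fintype E]

open Classical in
/-- The vertex set `V(D)`; isolated vertices are ignored. -/
noncomputable def verts (D : MultiDigraph V E) : Finset V :=
  Finset.univ.filter fun v => ∃ e, D.src e = v ∨ D.tgt e = v

/-- The in-degree `deg⁻(v)`, counted with multiplicity. -/
def inDeg (D : MultiDigraph V E) (v : V) : ℕ :=
  (Finset.univ.filter fun e => D.tgt e = v).card

/-- `D` is Eulerian: it has an Euler circuit, that is, a cyclic sequence of arcs that contains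
every arc exactly once and in which each arc ends where the next one starts. -/
def IsEulerian (D : MultiDigraph V E) : Prop :=
  ∃ c : Cycle E, c.Nodup ∧ (∀ e, e ∈ c) ∧ c.Chain fun a b => D.tgt a = D.src b

/-- The set of arcs `T` is a spanning arborescence of `D` with root `r`: no arc of `T` enters `r`,
exactly one arc of `T` enters each other vertex, and each vertex can be reached from `r`
along arcs of `T`. -/
def IsArborescence (D : MultiDigraph V E) (r : V) (T : Finset E) : Prop :=
  (∀ e ∈ T, D.tgt e ≠ r) ∧
  (∀ v ∈ D.verts, v ≠ r → ∃! e, e ∈ T ∧ D.tgt e = v) ∧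
  (∀ v ∈ D.verts, Relation.ReflTransGen (fun a b => ∃ e ∈ T, D.src e = a ∧ D.tgt e = b) r v)

open Classical in
/-- The number of spanning arborescences of `D` with specified root `r`. -/
noncomputable def numArborescences (D : MultiDigraph V E) (r : V) : ℕ :=
  (Finset.univ.filter fun T : Finset E => D.IsArborescence r T).card

end MultiDigraph

/-- A multi-hypergraph on `V`: a multiset of edges, each edge being a set of vertices. -/
structure MultiHypergraph (V : Type*) where
  edges : Multiset (Finset V)

namespace MultiHypergraph

variable {V : Type*} [Fintype V] [LinearOrder V]

/-- The arcs of the union of the stars `S_{e_i}(v_i)`, where `R i = (e_i, v_i)`: the pair `(i, v)`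
is the arc from `v_i` to `v` in the `i`-th star. -/
abbrev RootedArc {m : ℕ} (R : Fin m → Finset V × V) : Type _ :=
  {p : Fin m × V // p.2 ∈ (R p.1).1 ∧ p.2 ≠ (R p.1).2}

/-- The rooted multi-digraph `D_R` of `R`: the union, with multiplicities added, of the
stars `S_{e_i}(v_i) = (e_i, {v_i v : v ∈ e_i, v ≠ v_i})`, where `R i = (e_i, v_i)`. -/
def rootedDigraph {m : ℕ} (R : Fin m → Finset V × V) : MultiDigraph V (RootedArc R) where
  src p := (R p.1.1).2
  tgt p := p.1.2

/-- `R = ((e_1, v_1), …, (e_m, v_m))` is a rooting of `H`: the multiset of the `e_i` is `E(H)`,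
`v_i` is a vertex of `e_i`, and `v_1 ≤ v_2 ≤ ⋯ ≤ v_m`. -/
def IsRooting (H : MultiHypergraph V) {m : ℕ} (R : Fin m → Finset V × V) : Prop :=
  (Finset.univ.val.map fun i => (R i).1) = H.edges ∧
  (∀ i, (R i).2 ∈ (R i).1) ∧
  Monotone fun i => (R i).2

/-- An Euler rooting is a rooting whose rooted multi-digraph is Eulerian. -/
def IsEulerRooting (H : MultiHypergraph V) {m : ℕ} (R : Fin m → Finset V × V) : Prop :=
  H.IsRooting R ∧ (rootedDigraph R).IsEulerian

open Classical in
/-- The associated coefficient `C_H` of a connected Veblen hypergraph `H`: the sum of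
`τ_D / ∏_{v ∈ V(D)} deg⁻(v)` over the Euler rootings of `H`, where `D` is the rooted multi-digraph
and `τ_D` is the number of its arborescences with the specified root `r`. -/
noncomputable def assocCoeff (H : MultiHypergraph V) (r : V) : ℚ :=
  ∑ R : Fin (Multiset.card H.edges) → Finset V × V with H.IsEulerRooting R,
    ((rootedDigraph R).numArborescences r : ℚ) /
      ∏ v ∈ (rootedDigraph R).verts, ((rootedDigraph R).inDeg v : ℚ)

/-- The `k`-uniform simplex: `k + 1` vertices, and all `k`-subsets as edges, each once. -/
def simplex (k : ℕ) : MultiHypergraph (Fin (k + 1)) where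
  edges := (Finset.powersetCard k Finset.univ).val

/-- The simplex constant `C_k = (k - 1)^k C_H`, where `H` is the `k`-uniform simplex and `r` is the
root that is specified for counting arborescences. -/
noncomputable def simplexConst (k : ℕ) (r : Fin (k + 1)) : ℚ :=
  ((k : ℚ) - 1) ^ k * (simplex k).assocCoeff r

end MultiHypergraph

/-- The partitions of `n` into parts of size at least `2`. -/
def partitionsGeTwo (n : ℕ) : Finset n.Partition :=
  Finset.univ.filter fun p => ∀ i ∈ p.parts, 2 ≤ i

/-- The derangements of an `n`-element set whose cycle lengths are the parts of `p`. -/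
def derangementsOfType (n : ℕ) (p : n.Partition) : Set (Equiv.Perm (Fin n)) :=
  {σ | σ ∈ derangements (Fin n) ∧ σ.cycleType = p.parts}

/-! Suppose $m_v$ edges of the simplex are rooted at $v$. Exactly $k$ edges contain $v$, so $v$ has
in-degree $k-m_v$ and out-degree $(k-1)m_v$ in $D_R$. An Euler circuit forces these to agree, hence
$m_v=1$, and monotonicity gives $v_i=i$. The edge rooted at $i$ misses one vertex $\sigma(i)\ne i$,
so Euler rootings are derangements $\sigma$; conversely each derangement gives a balanced, connected
digraph (`isEulerRooting_simplex_iff`).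

All in-degrees are then $k-1$, and $i\to v$ is an arc unless $v\in\{i,\sigma(i)\}$, so the Laplacian
satisfies $L+J=kI+P_\sigma$ with $J$ the all-ones matrix. The matrix-tree theorem
(`numArborescences_eq_det`) makes $\tau$ a cofactor of $L$, and $\det(L+J)=(k+1)^2\tau$
(`det_add_ones`). Finally $\det(kI+P_\sigma)$ factors over the cycles of $\sigma$
(`det_add_permMatrix`), and grouping derangements by cycle type gives the sum over partitions. -/

/-! ### Cofactors of matrices with zero row and column sums -/

namespace Matrix

variable {n R : Type*} [Fintype n] [DecidableEq n]

/-- If all columns of `L` sum to zero, the cofactors along a column agree. -/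
theorem det_updateCol_single_eq [CommRing R] [IsDomain R] {L : Matrix n n R}
    (hcol : 1 ᵥ* L = 0) (r i : n) :
    (L.updateCol r (Pi.single i 1)).det = (L.updateCol r (Pi.single r 1)).det := by
  -- The new column also sums to zero, so the all-ones vector is in the left kernel.
  have h : (L.updateCol r (Pi.single i 1 - Pi.single r 1)).det = 0 := by
    rw [← exists_vecMul_eq_zero_iff]
    refine ⟨1, fun h => one_ne_zero (congrFun h r), ?_⟩
    ext j
    by_cases hj : j = r
    · subst hj
      simp [vecMul, dotProduct]
    · have := congrFun hcol j
      simpa [vecMul, dotProduct, hj] using this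
  rw [← cramer_apply, map_sub, Pi.sub_apply, cramer_apply, cramer_apply] at h
  exact sub_eq_zero.mp h

/-- The determinant of `L + J`, where `J` is the all-ones matrix and the rows and columns of `L`
sum to zero, in terms of a cofactor of `L`. -/
theorem det_add_ones [CommRing R] [IsDomain R] {L : Matrix n n R}
    (hrow : L *ᵥ 1 = 0) (hcol : 1 ᵥ* L = 0) (r : n) :
    (L + of fun _ _ => 1).det =
      (Fintype.card n : R) ^ 2 * (L.updateCol r (Pi.single r 1)).det := by
  set B : Matrix n n R := L + of fun _ _ => 1 with hB
  have h1 : B *ᵥ 1 = (Fintype.card n : R) • (1 : n → R) := by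
    rw [hB, add_mulVec, hrow]
    ext i
    simp [mulVec, dotProduct]
  -- Cramer's rule for `B *ᵥ 1`, a constant vector because the rows of `L` sum to zero.
  have h2 : B.det = (Fintype.card n : R) * (B.updateCol r 1).det := by
    have : cramer B (B *ᵥ 1) r = B.det := by
      rw [cramer_eq_adjugate_mulVec, mulVec_mulVec, adjugate_mul, smul_mulVec, one_mulVec]
      simp
    rw [← this, h1, map_smul, Pi.smul_apply, smul_eq_mul, cramer_apply]
  -- Subtracting the all-ones column `r` from every other column removes $J$.
  have h3 : (B.updateCol r 1).det = (L.updateCol r 1).det := by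
    rw [← det_transpose, ← det_transpose (L.updateCol r 1)]
    refine det_eq_of_forall_row_eq_smul_add_const (fun i => if i = r then 0 else 1) r
      (by simp) fun i j => ?_
    by_cases hi : i = r
    · subst hi; simp
    · simp [hi, hB]
  have h4 : (L.updateCol r 1).det =
      (Fintype.card n : R) * (L.updateCol r (Pi.single r 1)).det := by
    have : (1 : n → R) = ∑ i, Pi.single i 1 := (Finset.univ_sum_single 1).symm
    rw [← cramer_apply, this, map_sum, Finset.sum_apply]
    simp_rw [cramer_apply, det_updateCol_single_eq hcol r]
    simp
  rw [h2, h3, h4]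
  ring

end Matrix

/-! ### The determinant of $xI+P_\sigma$ -/

namespace Equiv.Perm

open Matrix

variable {n R : Type*} [DecidableEq n] [CommRing R]

theorem permMatrix_apply (σ : Perm n) (i j : n) :
    σ.permMatrix R i j = if σ i = j then 1 else 0 := by
  simp [PEquiv.toMatrix_apply, Equiv.toPEquiv_apply, eq_comm]

theorem add_permMatrix_apply (x : R) (σ : Perm n) (i j : n) :
    (x • (1 : Matrix n n R) + σ.permMatrix R) i j =
      (if i = j then x else 0) + if σ i = j then 1 else 0 := by
  simp only [Matrix.add_apply, Matrix.smul_apply, Matrix.one_apply, permMatrix_apply]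
  simp

variable [Fintype n]

/-- If `τ` moves every point either trivially or along the cycle `σ`, it is `1` or `σ`. -/
theorem IsCycle.eq_one_or_eq_of_forall {σ τ : Perm n} (hσ : σ.IsCycle)
    (h : ∀ i, τ i = i ∨ τ i = σ i) : τ = 1 ∨ τ = σ := by
  -- `τ` cannot fix `σ i`, which is already the image of `i`; so agreement with `σ` propagates along
  -- the cycle.
  have step : ∀ i, σ i ≠ i → τ i = σ i → τ (σ i) = σ (σ i) := by
    intro i hi hti
    refine (h (σ i)).resolve_left fun h' => hi ?_
    exact (τ.injective (h'.trans hti.symm))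
  by_cases hex : ∃ i, σ i ≠ i ∧ τ i = σ i
  · right
    obtain ⟨i, hi, hti⟩ := hex
    ext j
    by_cases hj : σ j = j
    · rcases h j with h' | h' <;> simp [h', hj]
    · obtain ⟨m, -, rfl⟩ := (hσ.sameCycle hi hj).exists_pow_eq'
      clear hj
      induction m with
      | zero => simpa using hti
      | succ m ih =>
        have hm : σ ((σ ^ m) i) ≠ (σ ^ m) i := by
          rw [Ne, ← mul_apply, ← pow_succ', pow_succ, mul_apply]
          exact fun h => hi ((σ ^ m).injective h)
        rw [pow_succ', mul_apply]
        exact step _ hm ih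
  · left
    push Not at hex
    ext j
    by_cases hj : σ j = j
    · rcases h j with h' | h' <;> simp [h', hj]
    · exact (h j).resolve_right (hex j hj)

/-- A nonzero Leibniz term uses only entries at $(i,i)$ and $(i,\sigma i)$, so only the terms of `1`
and `σ` survive. At a fixed point of `σ` the two entries coincide and add up to $x+1$. -/
theorem IsCycle.det_add_permMatrix {σ : Perm n} (hσ : σ.IsCycle) (x : R) :
    (x • (1 : Matrix n n R) + σ.permMatrix R).det =
      (x + 1) ^ (Fintype.card n - σ.support.card) *
        (x ^ σ.support.card + (-1) ^ (σ.support.card + 1)) := by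
  rw [← det_transpose, det_apply', ← Finset.sum_subset (Finset.subset_univ {1, σ}),
    Finset.sum_pair hσ.ne_one.symm]
  · have hc : (Finset.univ.filter fun i => ¬ σ i ≠ i).card = Fintype.card n - σ.support.card := by
      rw [← Finset.card_compl]
      congr 1
      ext
      simp
    have hs : (Finset.univ.filter fun i => σ i ≠ i).card = σ.support.card := rfl
    have h1 : ∏ i, (x • (1 : Matrix n n R) + σ.permMatrix R)ᵀ ((1 : Perm n) i) i =
        x ^ σ.support.card * (x + 1) ^ (Fintype.card n - σ.support.card) := by
      rw [← hc, ← hs, ← Finset.prod_const, ← Finset.prod_const,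
        ← Finset.prod_filter_mul_prod_filter_not Finset.univ (fun i => σ i ≠ i)]
      congr 1 <;>
      · refine Finset.prod_congr rfl fun i hi => ?_
        rw [Finset.mem_filter] at hi
        rw [transpose_apply, add_permMatrix_apply]
        have := hi.2
        simp_all
    have h2 : ∏ i, (x • (1 : Matrix n n R) + σ.permMatrix R)ᵀ (σ i) i =
        (x + 1) ^ (Fintype.card n - σ.support.card) := by
      rw [← hc, ← Finset.prod_const,
        ← Finset.prod_filter_mul_prod_filter_not Finset.univ (fun i => σ i ≠ i)]
      have : ∏ i with σ i ≠ i, (x • (1 : Matrix n n R) + σ.permMatrix R)ᵀ (σ i) i = 1 := by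
        refine Finset.prod_eq_one fun i hi => ?_
        rw [Finset.mem_filter] at hi
        rw [transpose_apply, add_permMatrix_apply, if_neg (Ne.symm hi.2)]
        simp
      rw [this, one_mul]
      refine Finset.prod_congr rfl fun i hi => ?_
      rw [Finset.mem_filter, not_not] at hi
      rw [transpose_apply, add_permMatrix_apply]
      simp [hi.2]
    rw [h1, h2, hσ.sign]
    push_cast
    simp
    ring
  · intro τ _ hτ
    have : ∃ i, ¬ (τ i = i ∨ τ i = σ i) := by
      by_contra! h
      exact hτ (by simpa using hσ.eq_one_or_eq_of_forall h)
    obtain ⟨i, hi⟩ := this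
    push Not at hi
    rw [Finset.prod_eq_zero (Finset.mem_univ i), mul_zero]
    rw [transpose_apply, add_permMatrix_apply, if_neg hi.1.symm, if_neg hi.2.symm, add_zero]

/-- Disjointness means $(P_\sigma-1)(P_\tau-1)=0$, whence $(x+P_\sigma)(x+P_\tau)=(x+1)(x+P_\sigma
P_\tau)$. -/
theorem Disjoint.det_add_permMatrix_mul {σ τ : Perm n} (h : Disjoint σ τ) (x : R) :
    (x + 1) ^ Fintype.card n * (x • (1 : Matrix n n R) + (σ * τ).permMatrix R).det =
      (x • (1 : Matrix n n R) + σ.permMatrix R).det *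
        (x • (1 : Matrix n n R) + τ.permMatrix R).det := by
  have key : σ.permMatrix R * τ.permMatrix R + 1 = σ.permMatrix R + τ.permMatrix R := by
    rw [← permMatrix_mul, ← h.commute.eq]
    ext i j
    rcases h i with hi | hi
    · have : σ (τ i) = τ i := by
        rcases h (τ i) with h' | h'
        · exact h'
        · rw [τ.injective h', hi]
      simp only [Matrix.add_apply, Matrix.one_apply, permMatrix_apply, mul_apply, this, hi]
      rw [add_comm]
    · simp only [Matrix.add_apply, Matrix.one_apply, permMatrix_apply, mul_apply, hi]
  rw [← det_smul, ← det_mul, h.commute.eq, permMatrix_mul]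
  congr 1
  have key' := eq_sub_of_add_eq key
  simp only [add_mul, mul_add, smul_mul_assoc, one_mul, mul_smul_comm, mul_one, key']
  module

/-- Induction on disjoint cycles. The power of $k+1$ must be cancelled, so the scalar is a natural
number in characteristic zero. -/
theorem det_add_permMatrix [IsDomain R] [CharZero R] (k : ℕ) (σ : Perm n) :
    ((k : R) • (1 : Matrix n n R) + σ.permMatrix R).det =
      ((k : R) + 1) ^ (Fintype.card n - σ.support.card) *
        (σ.cycleType.map fun a => (k : R) ^ a + (-1) ^ (a + 1)).prod := by
  have hk : (k : R) + 1 ≠ 0 := by exact_mod_cast k.succ_ne_zero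
  induction σ using cycle_induction_on with
  | base_one =>
    have : (k : R) • (1 : Matrix n n R) + (1 : Matrix n n R) = ((k : R) + 1) • 1 := by module
    rw [permMatrix_one, this, det_smul]
    simp
  | base_cycles σ hσ =>
    rw [hσ.det_add_permMatrix, hσ.cycleType]
    simp
  | induction_disjoint σ τ h _ ihσ ihτ =>
    apply mul_left_cancel₀ (pow_ne_zero (Fintype.card n) hk)
    rw [h.det_add_permMatrix_mul, ihσ, ihτ, h.cycleType_mul, Multiset.map_add,
      Multiset.prod_add, h.card_support_mul]
    have h1 : σ.support.card + τ.support.card ≤ Fintype.card n := by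
      rw [← h.card_support_mul]
      exact Finset.card_le_univ _
    have h2 : (Fintype.card n - σ.support.card) + (Fintype.card n - τ.support.card) =
        Fintype.card n + (Fintype.card n - (σ.support.card + τ.support.card)) := by omega
    rw [mul_mul_mul_comm, ← pow_add, h2, pow_add, mul_assoc]

end Equiv.Perm

/-! ### The matrix-tree theorem -/

/-- A matrix with ones on the diagonal whose other nonzero entries strictly increase a rank has
determinant one. -/
theorem Matrix.det_eq_one_of_rank {V : Type*} [Fintype V] [DecidableEq V] (M : Matrix V V ℚ)
    (b : V → ℕ) (hdiag : ∀ v, M v v = 1) (hoff : ∀ u v, u ≠ v → M u v ≠ 0 → b u < b v) :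
    M.det = 1 := by
  have hM : Matrix.BlockTriangular M b := by
    intro i j hij
    by_contra h
    exact absurd (hoff i j (fun h => by simp [h] at hij) h) (by omega)
  rw [hM.det]
  refine Finset.prod_eq_one fun a _ => ?_
  have : M.toSquareBlock b a = 1 := by
    ext ⟨i, hi⟩ ⟨j, hj⟩
    by_cases hij : i = j
    · subst hij
      simp [Matrix.toSquareBlock_def, hdiag]
    · have : M i j = 0 := by
        by_contra h
        have := hoff i j hij h
        omega
      simp [Matrix.toSquareBlock_def, this, hij]
  rw [this, Matrix.det_one]

namespace MultiDigraph

open Matrix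

variable {V E : Type*}

section Selected

variable [DecidableEq E] [Fintype E]

/-- The arcs selected by `f`. -/
def selected (D : MultiDigraph V E) (f : V → Option E) : Finset E :=
  Finset.univ.filter fun e => f (D.tgt e) = some e

theorem mem_selected {D : MultiDigraph V E} {f : V → Option E} {e : E} :
    e ∈ D.selected f ↔ f (D.tgt e) = some e := by
  simp [selected]

/-- `v` can be reached from `r` along the arcs of `T`. -/
def Reaches (D : MultiDigraph V E) (T : Finset E) (r v : V) : Prop :=
  Relation.ReflTransGen (fun a b => ∃ e ∈ T, D.src e = a ∧ D.tgt e = b) r v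

theorem reaches_src_iff {D : MultiDigraph V E} {r v : V} {f : V → Option E} {e : E}
    (hv : v ≠ r) (he : f v = some e) (ht : D.tgt e = v) :
    D.Reaches (D.selected f) r (D.src e) ↔ D.Reaches (D.selected f) r v := by
  constructor
  · intro h
    exact h.tail ⟨e, mem_selected.2 (by rw [ht, he]), rfl, ht⟩
  · intro h
    rcases Relation.ReflTransGen.cases_tail h with h | ⟨b, hb, e', he', rfl, ht'⟩
    · exact absurd h hv
    · rw [mem_selected, ht', he, Option.some_inj] at he'
      rwa [he']

end Selected

variable [DecidableEq V] [Fintype E]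

/-- The in-degree Laplacian of a multidigraph. -/
def laplacian (D : MultiDigraph V E) : Matrix V V ℚ :=
  of fun u v => ∑ e with D.tgt e = v,
    ((if u = v then 1 else 0) - if u = D.src e then 1 else 0)

/-- The possible values at `v` of a function that selects an entering arc for each vertex
other than `r`. -/
def entering (D : MultiDigraph V E) (r v : V) : Finset (Option E) :=
  if v = r then {none} else (Finset.univ.filter fun e => D.tgt e = v).map Function.Embedding.some

theorem none_mem_entering {D : MultiDigraph V E} {r v : V} : none ∈ D.entering r v ↔ v = r := by
  unfold entering
  split_ifs with h <;> simp [h]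

theorem some_mem_entering {D : MultiDigraph V E} {r v : V} {e : E} :
    some e ∈ D.entering r v ↔ v ≠ r ∧ D.tgt e = v := by
  unfold entering
  split_ifs with h <;> simp [h]

/-- The column at `v` that is contributed to the reduced Laplacian by a selected arc. -/
def selectionCol (D : MultiDigraph V E) (v : V) : Option E → V → ℚ
  | none => Pi.single v 1
  | some e => fun u => (if u = v then 1 else 0) - if u = D.src e then 1 else 0

variable [DecidableEq E]

/-- The rank is the number of backward steps along selected arcs needed to reach `r`. -/
theorem exists_rank {D : MultiDigraph V E} {r : V} {f : V → Option E}
    (hf : ∀ v, f v ∈ D.entering r v) (hr : ∀ v, D.Reaches (D.selected f) r v) :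
    ∃ b : V → ℕ, ∀ v e, f v = some e → b (D.src e) < b v := by
  let g : V → V := fun v => (f v).elim v D.src
  have hex : ∀ v, ∃ m, g^[m] v = r := by
    intro v
    induction hr v with
    | refl => exact ⟨0, rfl⟩
    | @tail b c _ hbc ih =>
      obtain ⟨e, he, rfl, rfl⟩ := hbc
      obtain ⟨m, hm⟩ := ih
      refine ⟨m + 1, ?_⟩
      rw [mem_selected] at he
      simpa [g, he] using hm
  refine ⟨fun v => Nat.find (hex v), fun v e he => ?_⟩
  have hv : v ≠ r := (some_mem_entering.1 (he ▸ hf v)).1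
  have hgv : g v = D.src e := by simp [g, he]
  obtain ⟨m, hm⟩ : ∃ m, Nat.find (hex v) = m + 1 := by
    refine Nat.exists_eq_succ_of_ne_zero fun h0 => hv ?_
    have := Nat.find_spec (hex v)
    rw [h0] at this
    exact this
  have hspec := Nat.find_spec (hex v)
  rw [hm, Function.iterate_succ_apply, hgv] at hspec
  show Nat.find (hex (D.src e)) < Nat.find (hex v)
  have := Nat.find_min' (hex (D.src e)) hspec
  omega

variable [Fintype V]

-- If every vertex is reached, distance from the root makes the matrix unitriangular; the diagonal
-- is 1 because there are no loops. Otherwise the indicator of the unreached vertices is a kernel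
-- vector: a selected arc has both ends reached or both unreached.
open Classical in
theorem det_selectionCol {D : MultiDigraph V E} (hD : ∀ e, D.src e ≠ D.tgt e) {r : V}
    {f : V → Option E} (hf : ∀ v, f v ∈ D.entering r v) :
    (of fun v => D.selectionCol v (f v)).det =
      if ∀ v, D.Reaches (D.selected f) r v then 1 else 0 := by
  rw [← det_transpose]
  split_ifs with hr
  · obtain ⟨b, hb⟩ := exists_rank hf hr
    refine Matrix.det_eq_one_of_rank _ b (fun v => ?_) fun u v huv h => ?_
    · rw [transpose_apply, of_apply]
      rcases hfv : f v with _ | e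
      · simp [selectionCol]
      · have := (some_mem_entering.1 (hfv ▸ hf v)).2
        have : v ≠ D.src e := fun h => hD e (by rw [← h, this])
        simp [selectionCol, this]
    · rw [transpose_apply, of_apply] at h
      rcases hfv : f v with _ | e
      · rw [hfv] at h
        simp [selectionCol, huv] at h
      · have : u = D.src e := by
          by_contra hne
          rw [hfv] at h
          simp [selectionCol, huv, hne] at h
        exact this ▸ hb v e hfv
  · push Not at hr
    obtain ⟨w, hw⟩ := hr
    rw [← exists_vecMul_eq_zero_iff]
    refine ⟨fun v => if D.Reaches (D.selected f) r v then 0 else 1,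
      fun h => by simpa [hw] using congrFun h w, ?_⟩
    ext v
    simp only [vecMul, dotProduct, transpose_apply, of_apply, Pi.zero_apply]
    rcases hfv : f v with _ | e
    · have : v = r := none_mem_entering.1 (hfv ▸ hf v)
      subst this
      have : D.Reaches (D.selected f) v v := Relation.ReflTransGen.refl
      simp [selectionCol, Pi.single_apply, this]
    · obtain ⟨hv, ht⟩ := some_mem_entering.1 (hfv ▸ hf v)
      simp only [selectionCol, mul_sub, Finset.sum_sub_distrib, mul_ite, mul_one, mul_zero,
        Finset.sum_ite_eq', Finset.mem_univ, if_true, reaches_src_iff hv hfv ht, sub_self]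

open Classical in
theorem card_selections {D : MultiDigraph V E} (hD : D.verts = Finset.univ) (r : V) :
    ((Fintype.piFinset (D.entering r)).filter
      fun f => ∀ v, D.Reaches (D.selected f) r v).card = D.numArborescences r := by
  refine Finset.card_bij (fun f _ => D.selected f) ?_ ?_ ?_
  · intro f hf
    rw [Finset.mem_filter, Fintype.mem_piFinset] at hf
    obtain ⟨hf, hr⟩ := hf
    rw [Finset.mem_filter]
    refine ⟨Finset.mem_univ _, fun e he => ?_, fun v _ hv => ?_, fun v _ => hr v⟩
    · rw [mem_selected] at he
      exact (some_mem_entering.1 (he ▸ hf (D.tgt e))).1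
    · rcases hfv : f v with _ | e
      · exact absurd (none_mem_entering.1 (hfv ▸ hf v)) hv
      · have ht := (some_mem_entering.1 (hfv ▸ hf v)).2
        refine ⟨e, ⟨mem_selected.2 (by rw [ht, hfv]), ht⟩, ?_⟩
        rintro e' ⟨he', rfl⟩
        rw [mem_selected, hfv, Option.some_inj] at he'
        exact he'.symm
  · intro f hf f' hf' h
    rw [Finset.mem_filter, Fintype.mem_piFinset] at hf hf'
    ext1 v
    rcases hfv : f v with _ | e
    · have hv := none_mem_entering.1 (hfv ▸ hf.1 v)
      rcases hfv' : f' v with _ | e'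
      · rfl
      · exact absurd hv (some_mem_entering.1 (hfv' ▸ hf'.1 v)).1
    · have ht := (some_mem_entering.1 (hfv ▸ hf.1 v)).2
      have : e ∈ D.selected f := mem_selected.2 (by rw [ht, hfv])
      rw [h, mem_selected, ht] at this
      exact this.symm
  · intro T hT
    rw [Finset.mem_filter] at hT
    obtain ⟨-, hroot, huniq, hreach⟩ := hT
    simp only [hD, Finset.mem_univ, true_imp_iff] at huniq hreach
    choose a ha ha' using huniq
    let f : V → Option E := fun v => if hv : v = r then none else some (a v hv)
    have hsel : D.selected f = T := by
      ext e
      rw [mem_selected]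
      constructor
      · intro h
        by_cases hr : D.tgt e = r
        · simp [f, hr] at h
        · simp only [f, hr, dite_false, Option.some_inj] at h
          rw [← h]
          exact (ha _ hr).1
      · intro h
        have hr := hroot e h
        simp only [f, hr, dite_false]
        rw [← ha' _ hr e ⟨h, rfl⟩]
    refine ⟨f, ?_, hsel⟩
    rw [Finset.mem_filter, Fintype.mem_piFinset]
    refine ⟨fun v => ?_, fun v => by rw [hsel]; exact hreach v⟩
    by_cases hv : v = r
    · simp [f, hv, none_mem_entering]
    · simp only [f, hv, dite_false]
      exact some_mem_entering.2 ⟨hv, (ha v hv).2⟩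

/-- The matrix-tree theorem for multidigraphs without loops. -/
theorem numArborescences_eq_det {D : MultiDigraph V E} (hloop : ∀ e, D.src e ≠ D.tgt e)
    (hD : D.verts = Finset.univ) (r : V) :
    (D.numArborescences r : ℚ) = (D.laplacian.updateCol r (Pi.single r 1)).det := by
  classical
  rw [← card_selections hD r, Finset.card_filter, Nat.cast_sum, ← det_transpose]
  have h : (D.laplacian.updateCol r (Pi.single r 1))ᵀ =
      of fun v => ∑ o ∈ D.entering r v, D.selectionCol v o := by
    ext v u
    rw [transpose_apply, of_apply, Finset.sum_apply]
    by_cases hv : v = r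
    · subst hv
      simp [entering, selectionCol]
    · simp [entering, selectionCol, hv, laplacian]
  rw [h]
  -- Multilinearity expands the determinant over all choices of one entering arc per non-root
  -- vertex.
  have h' := (detRowAlternating (n := V) (R := ℚ)).toMultilinearMap.map_sum_finset
    (fun v o => D.selectionCol v o) (D.entering r)
  refine Eq.trans ?_ h'.symm
  refine Finset.sum_congr rfl fun f hf => ?_
  rw [Fintype.mem_piFinset] at hf
  refine Eq.trans ?_ (det_selectionCol hloop hf).symm
  split_ifs <;> simp

end MultiDigraph

/-! ### Euler circuits and balanced digraphs -/

namespace Equiv.Perm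

variable {α : Type*} [DecidableEq α]

/-- Composing `π` with the transposition of two points on different cycles merges the cycles. -/
theorem SameCycle.mul_swap {π : Perm α} [Finite α] {a b x : α} (hab : ¬ π.SameCycle a b)
    (hx : π.SameCycle a x ∨ x = b) : (π * swap a b).SameCycle a x := by
  set ρ := π * swap a b with hρ
  have hρa : ρ a = π b := by simp [hρ]
  have hρb : ρ b = π a := by simp [hρ]
  have hρx : ∀ x, x ≠ a → x ≠ b → ρ x = π x := fun x h1 h2 => by
    simp [hρ, swap_apply_of_ne_of_ne h1 h2]
  have forward : ∀ x, ρ.SameCycle x (ρ x) := fun x => sameCycle_apply_right.2 (SameCycle.refl _ _)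
  have orbitA : ∀ m : ℕ, ρ.SameCycle (π a) (π ((π ^ m) a)) := by
    intro m
    induction m with
    | zero => exact SameCycle.refl _ _
    | succ m ih =>
      rw [pow_succ', mul_apply]
      by_cases h : π ((π ^ m) a) = a
      · rw [h]
      · rw [← hρx _ h]
        · exact ih.trans (forward _)
        · rintro h'
          exact hab ⟨(m + 1 : ℕ), by rw [zpow_natCast, pow_succ', mul_apply, h']⟩
  have orbitB : ∀ m : ℕ, ρ.SameCycle (π b) (π ((π ^ m) b)) := by
    intro m
    induction m with
    | zero => exact SameCycle.refl _ _
    | succ m ih =>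
      rw [pow_succ', mul_apply]
      by_cases h : π ((π ^ m) b) = b
      · rw [h]
      · rw [← hρx _ _ h]
        · exact ih.trans (forward _)
        · rintro h'
          exact hab (SameCycle.symm ⟨(m + 1 : ℕ), by rw [zpow_natCast, pow_succ', mul_apply, h']⟩)
  -- `ρ` jumps from `a` to `π b`, then follows the old cycle of `b` round to `b`.
  have toB : ρ.SameCycle a b := by
    obtain ⟨m, hm⟩ := (sameCycle_apply_left.2 (SameCycle.refl π b)).exists_nat_pow_eq
    have h1 : ρ.SameCycle a (π b) := hρa ▸ forward a
    have h2 := orbitB m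
    rw [← mul_apply, ← pow_succ', pow_succ, mul_apply, hm] at h2
    exact h1.trans h2
  rcases hx with hx | rfl
  · obtain ⟨m, hm⟩ := (sameCycle_apply_left.2 hx).exists_nat_pow_eq
    have h1 : ρ.SameCycle b (π a) := hρb ▸ forward b
    have h2 := orbitA m
    rw [← mul_apply, ← pow_succ', pow_succ, mul_apply, hm] at h2
    exact toB.trans (h1.trans h2)
  · exact toB

end Equiv.Perm

namespace MultiDigraph

open Equiv

variable {V E : Type*}

theorem isChain_map_eq {D : MultiDigraph V E} (l : List E) (a b : E)
    (h : List.IsChain (fun a b => D.tgt a = D.src b) (a :: (l ++ [b]))) :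
    (a :: l).map D.tgt = (l ++ [b]).map D.src := by
  induction l generalizing a with
  | nil => simpa using h
  | cons c l ih =>
    rw [List.cons_append, List.isChain_cons_cons] at h
    rw [List.map_cons, ih c h.2, h.1]
    rfl

variable [Fintype E]

/-- `π` prescribes the arc to take next; its single orbit, listed from `e₀` over one minimal period,
is the circuit. -/
theorem isEulerian_of_sameCycle (D : MultiDigraph V E) (π : Perm E)
    (hπ : ∀ e, D.src (π e) = D.tgt e) (e₀ : E) (h : ∀ e, π.SameCycle e₀ e) : D.IsEulerian := by
  have hper : e₀ ∈ Function.periodicPts π := π.injective.mem_periodicPts e₀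
  obtain ⟨m, hm⟩ := Nat.exists_eq_succ_of_ne_zero
    (Function.minimalPeriod_pos_of_mem_periodicPts hper).ne'
  refine ⟨((List.range m.succ : Cycle ℕ)).map fun i => π^[i] e₀, ?_, fun e => ?_, ?_⟩
  · rw [Cycle.map_coe, Cycle.nodup_coe_iff]
    refine List.Nodup.map_on (fun i hi j hj hij => ?_) List.nodup_range
    rw [List.mem_range, ← hm] at hi hj
    exact Function.iterate_injOn_Iio_minimalPeriod hi hj hij
  · obtain ⟨i, hi⟩ := (h e).exists_nat_pow_eq
    rw [Cycle.map_coe, Cycle.mem_coe_iff, List.mem_map]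
    refine ⟨i % m.succ, List.mem_range.2 (Nat.mod_lt _ m.succ_pos), ?_⟩
    rw [← hm, Function.iterate_mod_minimalPeriod_eq, ← hi, Perm.iterate_eq_pow]
  · rw [Cycle.chain_map, Cycle.chain_range_succ]
    refine ⟨?_, fun i _ => ?_⟩
    · rw [← hπ, ← Function.iterate_succ_apply' π, ← hm, Function.iterate_minimalPeriod]
      rfl
    · rw [← hπ, ← Function.iterate_succ_apply' π]

variable [DecidableEq V]

theorem exists_perm_of_balanced (D : MultiDigraph V E)
    (hbal : ∀ v, D.inDeg v = (Finset.univ.filter fun e => D.src e = v).card) :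
    ∃ π : Perm E, ∀ e, D.src (π e) = D.tgt e := by
  have h : ∀ v, Nonempty ({e // D.tgt e = v} ≃ {e // D.src e = v}) := fun v =>
    ⟨Fintype.equivOfCardEq (by rw [Fintype.card_subtype, Fintype.card_subtype]; exact hbal v)⟩
  exact ⟨ofFiberEquiv fun v => (h v).some, fun e => ofFiberEquiv_map _ e⟩

/-- A balanced multidigraph in which every nonempty set of vertices that is closed under arcs
contains the sources of all arcs has an Euler circuit. -/
theorem isEulerian_of_balanced [Nonempty E] (D : MultiDigraph V E)
    (hbal : ∀ v, D.inDeg v = (Finset.univ.filter fun e => D.src e = v).card)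
    (hconn : ∀ S : Set V, S.Nonempty → (∀ e, D.src e ∈ S → D.tgt e ∈ S) → ∀ e, D.src e ∈ S) :
    D.IsEulerian := by
  classical
  let e₀ : E := Classical.arbitrary E
  let orbit : Perm E → Finset E := fun π => Finset.univ.filter fun e => π.SameCycle e₀ e
  -- Among all pairings of entering with leaving arcs, take one whose orbit of `e₀` is largest.
  obtain ⟨π, hπ, hmax⟩ := Finset.exists_max_image
    (Finset.univ.filter fun π : Perm E => ∀ e, D.src (π e) = D.tgt e) (fun π => (orbit π).card)
    (by
      obtain ⟨π, hπ⟩ := D.exists_perm_of_balanced hbal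
      exact ⟨π, by simpa using hπ⟩)
  simp only [Finset.mem_filter, Finset.mem_univ, true_and] at hπ hmax
  refine D.isEulerian_of_sameCycle π hπ e₀ ?_
  -- Otherwise exchanging the successors of `a` and `b`, which share a target, would merge two
  -- orbits and contradict maximality.
  have closed : ∀ a b, π.SameCycle e₀ a → D.tgt a = D.tgt b → π.SameCycle e₀ b := by
    intro a b ha hab
    by_contra hb
    have hnab : ¬ π.SameCycle a b := fun h => hb (ha.trans h)
    have hmerge : ∀ x, π.SameCycle a x ∨ x = b → (π * swap a b).SameCycle a x :=
      fun x hx => Perm.SameCycle.mul_swap hnab hx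
    have h₀ := hmerge e₀ (Or.inl ha.symm)
    have hlt : orbit π ⊂ orbit (π * swap a b) := by
      refine (Finset.ssubset_iff_of_subset fun x hx => ?_).2 ⟨b, ?_, ?_⟩
      · simp only [orbit, Finset.mem_filter, Finset.mem_univ, true_and] at hx ⊢
        exact h₀.symm.trans (hmerge x (Or.inl (ha.symm.trans hx)))
      · simp only [orbit, Finset.mem_filter, Finset.mem_univ, true_and]
        exact h₀.symm.trans (hmerge b (Or.inr rfl))
      · simpa [orbit] using hb
    refine absurd (hmax (π * swap a b) fun e => ?_) (not_le.2 (Finset.card_lt_card hlt))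
    rw [Perm.mul_apply, hπ]
    by_cases h1 : e = a
    · rw [h1, swap_apply_left, hab]
    by_cases h2 : e = b
    · rw [h2, swap_apply_right, hab]
    rw [swap_apply_of_ne_of_ne h1 h2]
  have hpre : ∀ f, (∃ a, π.SameCycle e₀ a ∧ D.tgt a = D.src f) → π.SameCycle e₀ f := by
    rintro f ⟨a, ha, haf⟩
    have := closed a (π.symm f) ha (by rw [haf, ← hπ, apply_symm_apply])
    rw [← Perm.sameCycle_apply_right, apply_symm_apply] at this
    exact this
  intro e
  refine hpre e (hconn {v | ∃ a, π.SameCycle e₀ a ∧ D.tgt a = v}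
    ⟨D.tgt e₀, e₀, Perm.SameCycle.refl _ _, rfl⟩
    (fun f hf => ⟨f, hpre f hf, rfl⟩) e)

/-- Along the circuit, the list of targets is a rotation of the list of sources. -/
theorem IsEulerian.balanced {D : MultiDigraph V E} (h : D.IsEulerian) (v : V) :
    D.inDeg v = (Finset.univ.filter fun e => D.src e = v).card := by
  obtain ⟨c, hnd, hmem, hch⟩ := h
  induction c using Quotient.inductionOn with | h l =>
  change Cycle.Nodup (l : Cycle E) at hnd
  change ∀ e, e ∈ (l : Cycle E) at hmem
  change Cycle.Chain _ (l : Cycle E) at hch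
  rw [Cycle.nodup_coe_iff] at hnd
  simp only [Cycle.mem_coe_iff] at hmem
  have huniv : (Finset.univ : Finset E).val = (l : Multiset E) :=
    (Multiset.Nodup.ext Finset.univ.nodup (Multiset.coe_nodup.2 hnd)).2 fun e => by simp [hmem e]
  have hperm : (l.map D.tgt).Perm (l.map D.src) := by
    cases l with
    | nil => simp
    | cons a l =>
      rw [Cycle.chain_coe_cons] at hch
      rw [isChain_map_eq l a a hch, List.map_append, List.map_cons]
      exact List.perm_append_comm
  have key : ∀ g : E → V, (Finset.univ.filter fun e => g e = v).card =
      Multiset.count v (Multiset.map g Finset.univ.val) := by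
    intro g
    rw [Multiset.count_map, Finset.card_def, Finset.filter_val]
    simp only [eq_comm]
  rw [inDeg, key, key, huniv, Multiset.map_coe, Multiset.map_coe, Multiset.coe_eq_coe.2 hperm]

end MultiDigraph

/-! ### Euler rootings of the simplex -/

namespace MultiHypergraph

open Equiv Matrix

section Arcs

variable {V : Type*} [Fintype V] [LinearOrder V] {m : ℕ} (R : Fin m → Finset V × V)

theorem sum_rootedArc {M : Type*} [AddCommMonoid M] (g : Fin m → V → M) :
    ∑ e : RootedArc R, g e.1.1 e.1.2 = ∑ i, ∑ v ∈ (R i).1.erase (R i).2, g i v := by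
  rw [← Finset.sum_subtype (Finset.univ.filter fun p : Fin m × V =>
    p.2 ∈ (R p.1).1 ∧ p.2 ≠ (R p.1).2) (by simp) (fun p => g p.1 p.2),
    Finset.sum_filter, Fintype.sum_prod_type]
  refine Finset.sum_congr rfl fun i _ => ?_
  rw [← Finset.sum_filter]
  refine Finset.sum_congr ?_ fun _ _ => rfl
  ext v
  simp [and_comm]

/-- Yields both the in-degrees (`g = 1`) and the Laplacian entries. -/
theorem sum_entering_rootedDigraph {M : Type*} [AddCommMonoid M] (g : V → M) (v : V) :
    ∑ e with (rootedDigraph R).tgt e = v, g ((rootedDigraph R).src e) =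
      ∑ i with v ∈ (R i).1.erase (R i).2, g (R i).2 := by
  rw [Finset.sum_filter, Finset.sum_filter]
  refine (sum_rootedArc R fun i u => if u = v then g (R i).2 else 0).trans ?_
  refine Finset.sum_congr rfl fun i _ => ?_
  rw [Finset.sum_ite_eq']

theorem inDeg_rootedDigraph (v : V) :
    (rootedDigraph R).inDeg v = (Finset.univ.filter fun i => v ∈ (R i).1.erase (R i).2).card := by
  rw [MultiDigraph.inDeg, Finset.card_eq_sum_ones, Finset.card_eq_sum_ones]
  exact sum_entering_rootedDigraph R (fun _ => 1) v

theorem card_leaving_rootedDigraph (v : V) :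
    (Finset.univ.filter fun e => (rootedDigraph R).src e = v).card =
      ∑ i with (R i).2 = v, ((R i).1.erase (R i).2).card := by
  rw [Finset.card_filter, Finset.sum_filter]
  refine (sum_rootedArc R fun i _ => if (R i).2 = v then 1 else 0).trans ?_
  refine Finset.sum_congr rfl fun i _ => ?_
  split_ifs <;> simp

end Arcs

variable {k : ℕ}

/-- The rooting of the simplex in which the edge that misses `σ i` has root `i`. -/
def simplexRooting (σ : Perm (Fin (k + 1))) (i : Fin (k + 1)) :
    Finset (Fin (k + 1)) × Fin (k + 1) :=
  (Finset.univ.erase (σ i), i)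

theorem card_edges_simplex : Multiset.card (simplex k).edges = k + 1 := by
  change (Finset.powersetCard k (Finset.univ : Finset (Fin (k + 1)))).card = k + 1
  rw [Finset.card_powersetCard, Finset.card_univ, Fintype.card_fin, Nat.choose_succ_self_right]

theorem simplexRooting_injective : Function.Injective (simplexRooting (k := k)) := by
  intro σ τ h
  ext1 i
  have := congrArg Prod.fst (congrFun h i)
  by_contra hne
  have hmem : τ i ∈ Finset.univ.erase (σ i) := by simp [Ne.symm hne]
  rw [show Finset.univ.erase (σ i) = Finset.univ.erase (τ i) from this] at hmem
  simp at hmem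

theorem isRooting_simplexRooting {σ : Perm (Fin (k + 1))} (hσ : ∀ i, σ i ≠ i) :
    (simplex k).IsRooting (simplexRooting σ) := by
  refine ⟨?_, fun i => by simp [simplexRooting, (hσ i).symm], fun i j h => h⟩
  have hinj : Function.Injective fun i => (simplexRooting σ i).1 := by
    intro i j h
    refine σ.injective (by_contra fun hne => ?_)
    have hmem : σ j ∈ Finset.univ.erase (σ i) := by simp [Ne.symm hne]
    rw [show Finset.univ.erase (σ i) = Finset.univ.erase (σ j) from h] at hmem
    simp at hmem
  refine (Multiset.Nodup.ext (Finset.univ.nodup.map hinj) (Finset.nodup _)).2 fun s => ?_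
  rw [Multiset.mem_map, Finset.mem_val, Finset.mem_powersetCard]
  constructor
  · rintro ⟨i, -, rfl⟩
    simp [simplexRooting]
  · rintro ⟨-, hs⟩
    have hc : sᶜ.card = 1 := by rw [Finset.card_compl, hs, Fintype.card_fin]; omega
    obtain ⟨a, ha⟩ := Finset.card_eq_one.1 hc
    refine ⟨σ.symm a, by simp, ?_⟩
    rw [simplexRooting, apply_symm_apply, ← Finset.compl_singleton, ← ha, compl_compl]

theorem filter_mem_simplexRooting (σ : Perm (Fin (k + 1))) (v : Fin (k + 1)) :
    (Finset.univ.filter fun i =>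
      v ∈ (simplexRooting σ i).1.erase (simplexRooting σ i).2) = {σ.symm v, v}ᶜ := by
  ext i
  simp only [simplexRooting, Finset.mem_filter, Finset.mem_univ, Finset.mem_erase, true_and,
    and_true, Finset.mem_compl, Finset.mem_insert, Finset.mem_singleton, not_or, eq_symm_apply]
  tauto

theorem inDeg_simplexRooting {σ : Perm (Fin (k + 1))} (hσ : ∀ i, σ i ≠ i) (v : Fin (k + 1)) :
    (rootedDigraph (simplexRooting σ)).inDeg v = k - 1 := by
  have : σ.symm v ≠ v := fun h => hσ v (by rw [eq_comm, ← symm_apply_eq, h])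
  rw [inDeg_rootedDigraph, filter_mem_simplexRooting, Finset.card_compl, Finset.card_pair this,
    Fintype.card_fin]
  omega

theorem exists_ne_ne (hk : 2 ≤ k) (u w : Fin (k + 1)) : ∃ x, x ≠ u ∧ x ≠ w := by
  have : ({u, w} : Finset (Fin (k + 1))).card < (Finset.univ : Finset (Fin (k + 1))).card :=
    Finset.card_le_two.trans_lt (by rw [Finset.card_univ, Fintype.card_fin]; omega)
  obtain ⟨x, -, hx⟩ := Finset.exists_mem_notMem_of_card_lt_card this
  exact ⟨x, by simpa using hx⟩

/-- The arc from `u` to `v` in the digraph of `simplexRooting σ`. -/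
def simplexArc (σ : Perm (Fin (k + 1))) (u v : Fin (k + 1)) (h₁ : v ≠ σ u) (h₂ : v ≠ u) :
    RootedArc (simplexRooting σ) :=
  ⟨(u, v), by simp [simplexRooting, h₁], h₂⟩

theorem isEulerian_simplexRooting (hk : 2 ≤ k) {σ : Perm (Fin (k + 1))} (hσ : ∀ i, σ i ≠ i) :
    (rootedDigraph (simplexRooting σ)).IsEulerian := by
  obtain ⟨x, hx⟩ := exists_ne_ne hk 0 (σ 0)
  have : Nonempty (RootedArc (simplexRooting σ)) := ⟨simplexArc σ 0 x hx.2 hx.1⟩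
  refine MultiDigraph.isEulerian_of_balanced _ (fun v => ?_) fun S ⟨u, hu⟩ hS e => ?_
  · have : (Finset.univ.filter fun i => (simplexRooting σ i).2 = v) = {v} := by
      ext
      rw [Finset.mem_filter, Finset.mem_singleton]
      simp [simplexRooting]
    rw [inDeg_simplexRooting hσ, card_leaving_rootedDigraph, this, Finset.sum_singleton,
      Finset.card_erase_of_mem (by simp [simplexRooting, (hσ v).symm])]
    simp [simplexRooting]
  · suffices ∀ w, w ∈ S from this _
    intro w
    by_contra hw
    -- A vertex of `S` has no arc to `w` only if `σ` sends it to `w`. By injectivity `S` would be a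
    -- singleton, yet `u` has an arc to a third vertex.
    have key : ∀ y ∈ S, σ y = w := by
      intro y hy
      by_contra hne
      exact hw (hS (simplexArc σ y w (Ne.symm hne) fun h => hw (h ▸ hy)) hy)
    obtain ⟨y, hyu, hyw⟩ := exists_ne_ne hk u w
    have hy : y ∈ S := hS (simplexArc σ u y (by rwa [key u hu]) hyu) hu
    exact hyu (σ.injective ((key y hy).trans (key u hu).symm))

theorem isEulerRooting_simplex_iff (hk : 2 ≤ k)
    (R : Fin (k + 1) → Finset (Fin (k + 1)) × Fin (k + 1)) :
    (simplex k).IsEulerRooting R ↔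
      ∃ σ : Perm (Fin (k + 1)), (∀ i, σ i ≠ i) ∧ simplexRooting σ = R := by
  constructor
  swap
  · rintro ⟨σ, hσ, rfl⟩
    exact ⟨isRooting_simplexRooting hσ, isEulerian_simplexRooting hk hσ⟩
  rintro ⟨⟨hedges, hmem, hmono⟩, heuler⟩
  have hcard : ∀ i, (R i).1.card = k := by
    intro i
    have : (R i).1 ∈ (Finset.powersetCard k Finset.univ).val := by
      change _ ∈ (simplex k).edges
      rw [← hedges]
      exact Multiset.mem_map_of_mem _ (Finset.mem_univ i)
    rw [Finset.mem_val, Finset.mem_powersetCard] at this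
    exact this.2
  have hinj : Function.Injective fun i => (R i).1 := by
    have : (Multiset.map (fun i => (R i).1) Finset.univ.val).Nodup := by
      rw [hedges]
      exact Finset.nodup _
    intro i j hij
    exact Multiset.inj_on_of_nodup_map this i (Finset.mem_univ i) j (Finset.mem_univ j) hij
  have hc : ∀ i, ∃ a, (R i).1 = Finset.univ.erase a := by
    intro i
    have : (R i).1ᶜ.card = 1 := by rw [Finset.card_compl, hcard, Fintype.card_fin]; omega
    obtain ⟨a, ha⟩ := Finset.card_eq_one.1 this
    exact ⟨a, by rw [← Finset.compl_singleton, ← ha, compl_compl]⟩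
  choose c hc using hc
  have hcinj : Function.Injective c := fun i j hij => hinj (by simp only [hc, hij])
  let σ : Perm (Fin (k + 1)) := Equiv.ofBijective c (Finite.injective_iff_bijective.1 hcinj)
  -- With $m$ edges rooted at `v`, balance and the $k$ edges through `v` give $m(k-1)+m=k$.
  have hmult : ∀ v, (Finset.univ.filter fun i => (R i).2 = v).card = 1 := by
    intro v
    have hbal := heuler.balanced v
    rw [inDeg_rootedDigraph, card_leaving_rootedDigraph,
      Finset.sum_congr rfl (fun i _ => by rw [Finset.card_erase_of_mem (hmem i), hcard]),
      Finset.sum_const, smul_eq_mul] at hbal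
    have hsum : (Finset.univ.filter fun i => v ∈ (R i).1.erase (R i).2).card +
        (Finset.univ.filter fun i => (R i).2 = v).card = k := by
      rw [← Finset.card_union_of_disjoint]
      · have : ((Finset.univ.filter fun i => v ∈ (R i).1.erase (R i).2) ∪
            Finset.univ.filter fun i => (R i).2 = v) = {σ.symm v}ᶜ := by
          ext i
          have hi : (R i).2 = v → v ≠ c i := by
            rintro rfl
            have := hmem i
            rw [hc] at this
            exact (Finset.mem_erase.1 this).1
          have hcσ : i = σ.symm v ↔ v = c i := by
            rw [eq_symm_apply, eq_comm]
            rfl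
          simp only [Finset.mem_union, Finset.mem_filter, Finset.mem_univ, true_and,
            Finset.mem_erase, hc, and_true, Finset.mem_compl, Finset.mem_singleton, hcσ]
          tauto
        rw [this, Finset.card_compl, Finset.card_singleton, Fintype.card_fin]
        omega
      · rw [Finset.disjoint_filter]
        intro i _ h1 h2
        exact (Finset.mem_erase.1 h1).1 h2.symm
    obtain ⟨k, rfl⟩ : ∃ l, k = l + 2 := ⟨k - 2, by omega⟩
    rw [hbal, show k + 2 - 1 = k + 1 from rfl] at hsum
    nlinarith
  -- A strictly increasing bijection of `Fin (k + 1)` is the identity.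
  have hroot : (fun i => (R i).2) = id := by
    have hstrict : StrictMono fun i => (R i).2 := by
      refine hmono.strictMono_of_injective fun i j hij => ?_
      refine Finset.card_le_one.1 (hmult (R j).2).le i ?_ j ?_
      · simpa using hij
      · simp
    have hbij := Finite.injective_iff_bijective.1 hstrict.injective
    refine hstrict.range_inj strictMono_id |>.1 ?_
    rw [hbij.2.range_eq, Set.range_id]
  refine ⟨σ, fun i => ?_, ?_⟩
  · have := hmem i
    rw [hc, congrFun hroot i] at this
    exact (Finset.mem_erase.1 this).1.symm
  · funext i
    exact Prod.ext (hc i).symm (congrFun hroot i).symm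

theorem verts_simplexRooting (hk : 2 ≤ k) (σ : Perm (Fin (k + 1))) :
    (rootedDigraph (simplexRooting σ)).verts = Finset.univ := by
  ext v
  obtain ⟨x, hx⟩ := exists_ne_ne hk v (σ v)
  simp only [MultiDigraph.verts, Finset.mem_filter, Finset.mem_univ, true_and, iff_true]
  exact ⟨simplexArc σ v x hx.2 hx.1, Or.inl rfl⟩

/-- Column `v` of the Laplacian is $k-1$ at `v`, $0$ at `σ.symm v` and $-1$ elsewhere, so adding
ones leaves only $k$ and $1$. -/
theorem laplacian_simplexRooting {σ : Perm (Fin (k + 1))} (hσ : ∀ i, σ i ≠ i) :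
    (rootedDigraph (simplexRooting σ)).laplacian + of (fun _ _ => 1) =
      (k : ℚ) • (1 : Matrix (Fin (k + 1)) (Fin (k + 1)) ℚ) + σ.permMatrix ℚ := by
  ext u v
  have hne : σ.symm v ≠ v := fun h => hσ v (by rw [eq_comm, ← symm_apply_eq, h])
  have hsum : (rootedDigraph (simplexRooting σ)).laplacian u v =
      ∑ i ∈ {σ.symm v, v}ᶜ, ((if u = v then 1 else 0) - if u = i then 1 else 0) := by
    rw [← filter_mem_simplexRooting]
    exact sum_entering_rootedDigraph (simplexRooting σ)
      (fun i => ((if u = v then 1 else 0) - if u = i then 1 else 0 : ℚ)) v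
  have hcard : (({σ.symm v, v}ᶜ : Finset (Fin (k + 1))).card : ℚ) = k - 1 := by
    rw [Finset.card_compl, Finset.card_pair hne, Fintype.card_fin, Nat.cast_sub]
    · push_cast
      ring
    · have := (Finset.card_pair hne).symm.trans_le (Finset.card_le_univ _)
      rwa [Fintype.card_fin] at this
  rw [Matrix.add_apply, hsum, Perm.add_permMatrix_apply, of_apply, Finset.sum_sub_distrib,
    Finset.sum_const, nsmul_eq_mul, hcard, Finset.sum_ite_eq]
  simp only [Finset.mem_compl, Finset.mem_insert, Finset.mem_singleton, eq_symm_apply]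
  by_cases huv : u = v
  · subst huv
    simp [hσ u]
  · by_cases h : σ u = v <;> simp [huv, h]

theorem numArborescences_simplexRooting (hk : 2 ≤ k) {σ : Perm (Fin (k + 1))}
    (hσ : ∀ i, σ i ≠ i) (r : Fin (k + 1)) :
    ((rootedDigraph (simplexRooting σ)).numArborescences r : ℚ) =
      (σ.cycleType.map fun a => (k : ℚ) ^ a + (-1) ^ (a + 1)).prod / ((k : ℚ) + 1) ^ 2 := by
  have hsupp : σ.support.card = k + 1 := by
    have : σ.support = Finset.univ := by
      ext i
      simp [hσ i]
    rw [this, Finset.card_univ, Fintype.card_fin]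
  have hL := laplacian_simplexRooting hσ
  rw [MultiDigraph.numArborescences_eq_det (fun e => e.2.2.symm) (verts_simplexRooting hk σ)]
  have hB := Perm.det_add_permMatrix (R := ℚ) k σ
  rw [← hL, Matrix.det_add_ones ?_ ?_ r, hsupp, Fintype.card_fin, Nat.sub_self, pow_zero, one_mul]
    at hB
  · rw [eq_div_iff (by positivity), ← hB]
    push_cast
    ring
  -- Rows and columns of $kI+P_\sigma$ sum to $k+1$, as do those of $J$.
  · rw [eq_sub_of_add_eq hL, sub_mulVec, add_mulVec, smul_mulVec, one_mulVec, permMatrix_mulVec]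
    ext i
    simp [mulVec, dotProduct]
  · rw [eq_sub_of_add_eq hL, vecMul_sub, vecMul_add, vecMul_smul, vecMul_one, vecMul_permMatrix]
    ext i
    simp [vecMul, dotProduct]

/-- The length of a rooting is the number of edges, only propositionally $k+1$; a variable `m`
allows the substitution. -/
theorem sum_eulerRootings_simplex (hk : 2 ≤ k) {m : ℕ} (hm : m = k + 1)
    (F : (Fin m → Finset (Fin (k + 1)) × Fin (k + 1)) → ℚ) (G : Perm (Fin (k + 1)) → ℚ)
    [DecidablePred fun R : Fin m → Finset (Fin (k + 1)) × Fin (k + 1) =>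
      (simplex k).IsEulerRooting R]
    (hFG : ∀ σ : Perm (Fin (k + 1)), (∀ i, σ i ≠ i) →
      F (fun i => simplexRooting σ (i.cast hm)) = G σ) :
    ∑ R with (simplex k).IsEulerRooting R, F R = ∑ σ with ∀ i, σ i ≠ i, G σ := by
  subst hm
  symm
  refine Finset.sum_bij (fun σ _ => simplexRooting σ) ?_ ?_ ?_ ?_
  · intro σ hσ
    rw [Finset.mem_filter] at hσ ⊢
    exact ⟨Finset.mem_univ _, (isEulerRooting_simplex_iff hk _).2 ⟨σ, hσ.2, rfl⟩⟩
  · intro σ _ τ _ h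
    exact simplexRooting_injective h
  · intro R hR
    rw [Finset.mem_filter] at hR
    obtain ⟨σ, hσ, rfl⟩ := (isEulerRooting_simplex_iff hk _).1 hR.2
    exact ⟨σ, by simpa using hσ, rfl⟩
  · intro σ hσ
    rw [Finset.mem_filter] at hσ
    exact (hFG σ hσ.2).symm

theorem assocCoeff_simplex (hk : 2 ≤ k) (r : Fin (k + 1)) :
    (simplex k).assocCoeff r =
      ∑ σ : Perm (Fin (k + 1)) with ∀ i, σ i ≠ i,
        (σ.cycleType.map fun a => (k : ℚ) ^ a + (-1) ^ (a + 1)).prod /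
          ((k : ℚ) + 1) ^ 2 / ((k : ℚ) - 1) ^ (k + 1) := by
  classical
  refine sum_eulerRootings_simplex hk card_edges_simplex _ _ fun σ hσ => ?_
  have key : ∀ (m : ℕ) (hm : m = k + 1),
      ((rootedDigraph fun i : Fin m => simplexRooting σ (i.cast hm)).numArborescences r : ℚ) /
        ∏ v ∈ (rootedDigraph fun i : Fin m => simplexRooting σ (i.cast hm)).verts,
          ((rootedDigraph fun i : Fin m => simplexRooting σ (i.cast hm)).inDeg v : ℚ) =
      (σ.cycleType.map fun a => (k : ℚ) ^ a + (-1) ^ (a + 1)).prod /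
          ((k : ℚ) + 1) ^ 2 / ((k : ℚ) - 1) ^ (k + 1) := by
    rintro m rfl
    change ((rootedDigraph (simplexRooting σ)).numArborescences r : ℚ) /
        ∏ v ∈ (rootedDigraph (simplexRooting σ)).verts,
          ((rootedDigraph (simplexRooting σ)).inDeg v : ℚ) = _
    rw [numArborescences_simplexRooting hk hσ, verts_simplexRooting hk]
    simp only [inDeg_simplexRooting hσ, Finset.prod_const, Finset.card_univ, Fintype.card_fin]
    rw [Nat.cast_sub (by omega), Nat.cast_one]
  exact key _ card_edges_simplex

end MultiHypergraph

/-! ### Derangements grouped by cycle type -/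

open Equiv

theorem Equiv.Perm.forall_ne_iff_sum_cycleType {n : ℕ} (σ : Perm (Fin n)) :
    (∀ i, σ i ≠ i) ↔ σ.cycleType.sum = n := by
  rw [Perm.sum_cycleType]
  have : σ.support.card = n ↔ σ.support = Finset.univ := by
    rw [← Finset.card_eq_iff_eq_univ, Fintype.card_fin]
  rw [this, Finset.eq_univ_iff_forall]
  simp

/-- `cycleType` omits fixed points, so a cycle type summing to `n` already forces a derangement. -/
theorem derangementsOfType_eq {n : ℕ} (p : n.Partition) :
    derangementsOfType n p =
      (Finset.univ.filter fun σ : Perm (Fin n) => σ.cycleType = p.parts) := by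
  ext σ
  simp only [derangementsOfType, Set.mem_ofPred_eq, Finset.coe_filter, Finset.mem_univ, true_and,
    and_iff_right_iff_imp]
  intro h
  exact σ.forall_ne_iff_sum_cycleType.2 (by rw [h, p.parts_sum])

theorem sum_derangements_eq_sum_partitions (n : ℕ) (w : Multiset ℕ → ℚ) :
    ∑ σ : Perm (Fin n) with ∀ i, σ i ≠ i, w σ.cycleType =
      ∑ p ∈ partitionsGeTwo n, ((derangementsOfType n p).ncard : ℚ) * w p.parts := by
  classical
  have h : ∀ p ∈ partitionsGeTwo n, ((derangementsOfType n p).ncard : ℚ) * w p.parts =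
      ∑ σ : Perm (Fin n) with ∀ i, σ i ≠ i,
        if σ.cycleType = p.parts then w σ.cycleType else 0 := by
    intro p _
    rw [derangementsOfType_eq, Set.ncard_coe_finset, ← Finset.sum_filter, Finset.filter_filter,
      ← nsmul_eq_mul, ← Finset.sum_const]
    refine Finset.sum_congr ?_ fun σ hσ => by rw [(Finset.mem_filter.1 hσ).2.2]
    ext σ
    simp only [Finset.mem_filter, Finset.mem_univ, true_and]
    exact ⟨fun h => ⟨σ.forall_ne_iff_sum_cycleType.2 (by rw [h, p.parts_sum]), h⟩, And.right⟩
  rw [Finset.sum_congr rfl h, Finset.sum_comm]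
  refine Finset.sum_congr rfl fun σ hσ => ?_
  rw [Finset.mem_filter] at hσ
  let q : n.Partition := ⟨σ.cycleType, fun hi => by
    have := Perm.two_le_of_mem_cycleType hi
    omega, σ.forall_ne_iff_sum_cycleType.1 hσ.2⟩
  rw [Finset.sum_eq_single_of_mem q]
  · rw [if_pos rfl]
  · simp only [partitionsGeTwo, Finset.mem_filter, Finset.mem_univ, true_and]
    exact fun i hi => Perm.two_le_of_mem_cycleType (σ := σ) hi
  · intro p _ hp
    exact if_neg fun h => hp (Nat.Partition.ext h.symm)

theorem ncard_derangementsOfType {n : ℕ} {p : n.Partition} (hp : p ∈ partitionsGeTwo n) :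
    ((derangementsOfType n p).ncard : ℚ) =
      (n.factorial : ℚ) /
        ((p.parts.prod : ℚ) * ∏ i ∈ Finset.Icc 2 n, ((p.parts.count i).factorial : ℚ)) := by
  simp only [partitionsGeTwo, Finset.mem_filter, Finset.mem_univ, true_and] at hp
  have h := Perm.card_of_cycleType_mul_eq (Fin n) p.parts
  rw [if_pos ⟨by rw [p.parts_sum, Fintype.card_fin], hp⟩, Fintype.card_fin, p.parts_sum,
    Nat.sub_self, Nat.factorial_zero, one_mul] at h
  -- Sizes that do not occur contribute $0!=1$.
  have hprod : ∏ i ∈ p.parts.toFinset, (p.parts.count i).factorial =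
      ∏ i ∈ Finset.Icc 2 n, (p.parts.count i).factorial := by
    refine Finset.prod_subset (fun i hi => ?_) fun i _ hi => ?_
    · rw [Multiset.mem_toFinset] at hi
      exact Finset.mem_Icc.2 ⟨hp i hi, p.parts_sum ▸ Multiset.le_sum_of_mem hi⟩
    · rw [Multiset.mem_toFinset] at hi
      rw [Multiset.count_eq_zero_of_notMem hi, Nat.factorial_zero]
  rw [hprod] at h
  have hpos : p.parts.prod ≠ 0 := by
    rw [Ne, Multiset.prod_eq_zero_iff]
    exact fun h0 => absurd (hp 0 h0) (by omega)
  rw [derangementsOfType_eq, Set.ncard_coe_finset, eq_div_iff]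
  · exact_mod_cast h
  · refine mul_ne_zero (by exact_mod_cast hpos) (Finset.prod_ne_zero_iff.2 fun i _ => ?_)
    exact_mod_cast Nat.factorial_ne_zero _

theorem corollary6p5 (k : ℕ) (hk : 2 ≤ k) (r : Fin (k + 1)) :
    MultiHypergraph.simplexConst k r =
      1 / (((k : ℚ) - 1) * ((k : ℚ) + 1) ^ 2) *
        ∑ p ∈ partitionsGeTwo (k + 1),
          ((derangementsOfType (k + 1) p).ncard : ℚ) *
            (p.parts.map fun a => (k : ℚ) ^ a + (-1) ^ (a + 1)).prod ∧
    ∀ p ∈ partitionsGeTwo (k + 1),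
      ((derangementsOfType (k + 1) p).ncard : ℚ) =
        ((k + 1).factorial : ℚ) /
          ((p.parts.prod : ℚ) *
            ∏ i ∈ Finset.Icc 2 (k + 1), ((p.parts.count i).factorial : ℚ)) := by
  refine ⟨?_, fun p hp => ncard_derangementsOfType hp⟩
  have hk1 : (k : ℚ) - 1 ≠ 0 := by
    have : (2 : ℚ) ≤ k := by exact_mod_cast hk
    linarith
  have hk2 : (k : ℚ) + 1 ≠ 0 := by positivity
  rw [MultiHypergraph.simplexConst, MultiHypergraph.assocCoeff_simplex hk,
    ← sum_derangements_eq_sum_partitions (k + 1)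
      (fun s => (s.map fun a => (k : ℚ) ^ a + (-1) ^ (a + 1)).prod), Finset.mul_sum,
    Finset.mul_sum]
  refine Finset.sum_congr rfl fun σ _ => ?_
  -- Of $(k-1)^{k+1}$, the product of in-degrees, the normalisation $(k-1)^k$ leaves one factor.
  rw [pow_succ]
  field_simp
  ring
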